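/- Let $a\ge 1$ be an integer and let $q,r$ be integers with $0\le r<q$. An $a$-derangement of length $n$ is a permutation of $\{1,\dots,n\}$ each of whose cycles is longer than $a$ (a fixed point being a cycle of length $1$). Let $d_a(n,k)$ be the number of $a$-derangements of length $n$ with exactly $k$ cycles, let $D(n,a)$ be the number of all $a$-derangements of length $n$, and put $m=\lfloor n/a\rfloor$. Then \[ \lim_{n\to\infty}\frac{\sum_{j=0}^{\lfloor m/q\rfloor} d_a(n,r+jq)}{D(n,a)} =\lim_{n\to\infty}\frac{d_a(n,r)+d_a(n,q+r)+\cdots+d_a\left(n,q\lfloor (m-r)/q\rfloor+r\right)}{D(n,a)} =\frac1q . \] In other words, the proportion of those $a$-derangements of length $n$ whose number of cycles is congruent to $r$ modulo $q$, among all $a$-derangements of length $n$, tends to $1/q$ as $n\to\infty$. -/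

import Mathlib

open Filter Topology

/-- The multiset of the lengths of all cycles of `σ`, a fixed point being a cycle of length `1`. -/
def cycleLengths {n : ℕ} (σ : Equiv.Perm (Fin n)) : Multiset ℕ :=
  σ.partition.parts

/-- The number of cycles of `σ`, fixed points included. -/
def numCycles {n : ℕ} (σ : Equiv.Perm (Fin n)) : ℕ :=
  Multiset.card (cycleLengths σ)

/-- An `a`-derangement: a permutation each cycle of which is longer than `a`
(a fixed point being a cycle of length `1`). -/
def IsADerangement (a : ℕ) {n : ℕ} (σ : Equiv.Perm (Fin n)) : Prop :=
  ∀ l ∈ cycleLengths σ, a < l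

instance (a n : ℕ) (σ : Equiv.Perm (Fin n)) : Decidable (IsADerangement a σ) :=
  inferInstanceAs (Decidable (∀ l ∈ cycleLengths σ, a < l))

/-- The number `D(n,a)` of `a`-derangements of length `n`. -/
def numADerangements (a n : ℕ) : ℕ :=
  (Finset.univ.filter fun σ : Equiv.Perm (Fin n) => IsADerangement a σ).card

/-- The number `d_a(n,k)` of `a`-derangements of length `n` with exactly `k` cycles. -/
def numADerangementsWithCycles (a n k : ℕ) : ℕ :=
  (Finset.univ.filter fun σ : Equiv.Perm (Fin n) =>
    IsADerangement a σ ∧ numCycles σ = k).card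

/-- The number of `a`-derangements of length `n` whose number of cycles is congruent to `r`
modulo `q`. -/
def numADerangementsCyclesMod (a n r q : ℕ) : ℕ :=
  (Finset.univ.filter fun σ : Equiv.Perm (Fin n) =>
    IsADerangement a σ ∧ numCycles σ ≡ r [MOD q]).card

/-! By the roots-of-unity filter (`mul_numADerangementsCyclesMod`), it suffices that the mean of `x
^ numCycles` over `a`-derangements tends to `0` for each `q`-th root of unity `x ≠ 1`; the root `x =
1` alone contributes the limit `1 / q`. Divided by `n!`, the sum of `x ^ numCycles` is a sequence
`p` with `p 0 = 1` and `n * p n = x * ∑ j < n - a, p j` (`natCast_mul_derangementCoeff`). For `x =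
1` it stays above a positive constant (`exists_pos_le_of_recurrence`). For `x ≠ 1` on the unit
circle, `Re x < 1` makes the partial sums `O(n ^ ρ)` for some `ρ < 1`, so `p n = O(n ^ (ρ - 1))`
(`tendsto_zero_of_recurrence`). -/

/-! ### Asymptotics of the recurrence -/

theorem norm_le_one_of_recurrence {a : ℕ} {x : ℂ} (hx : ‖x‖ = 1) {p : ℕ → ℂ} (h0 : p 0 = 1)
    (hp : ∀ n : ℕ, (n : ℂ) * p n = x * ∑ j ∈ Finset.range (n - a), p j) (n : ℕ) :
    ‖p n‖ ≤ 1 := by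
  induction n using Nat.strong_induction_on with
  | _ n ih =>
    rcases Nat.eq_zero_or_pos n with rfl | hn
    · simp [h0]
    have hn' : (0 : ℝ) < n := by exact_mod_cast hn
    have h1 : (n : ℝ) * ‖p n‖ = ‖∑ j ∈ Finset.range (n - a), p j‖ := by
      have := congrArg norm (hp n)
      simpa [hx] using this
    have h2 : ‖∑ j ∈ Finset.range (n - a), p j‖ ≤ ∑ _j ∈ Finset.range (n - a), (1 : ℝ) :=
      norm_sum_le_of_le _ fun j hj => ih j (by have := Finset.mem_range.1 hj; omega)
    have h3 : ((n - a : ℕ) : ℝ) ≤ n := by exact_mod_cast Nat.sub_le n a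
    simp only [Finset.sum_const, Finset.card_range, nsmul_eq_mul, mul_one] at h2
    have : (n : ℝ) * ‖p n‖ ≤ n * 1 := by linarith
    exact le_of_mul_le_mul_left this hn'

theorem norm_sum_range_sub_le {p : ℕ → ℂ} (hp : ∀ n, ‖p n‖ ≤ 1) (a n : ℕ) :
    ‖∑ j ∈ Finset.range (n - a), p j - ∑ j ∈ Finset.range n, p j‖ ≤ a := by
  rw [norm_sub_rev, ← Finset.sum_Ico_eq_sub _ (Nat.sub_le n a)]
  refine (norm_sum_le_of_le _ fun j _ => hp j).trans ?_
  simp only [Finset.sum_const, Nat.card_Ico, nsmul_eq_mul, mul_one]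
  exact_mod_cast (by omega : n - (n - a) ≤ a)

/-- Bernoulli's inequality for exponents in `[0, 1]`, followed by `(1 + t) * (1 - t) ≤ 1`. It makes
`n ^ ρ` a supersolution of the growth recurrence below. -/
theorem one_add_div_mul_rpow_le {ρ : ℝ} (h0 : 0 ≤ ρ) (h1 : ρ ≤ 1) (n : ℕ) :
    (1 + ρ / (n + 1)) * (n : ℝ) ^ ρ ≤ ((n : ℝ) + 1) ^ ρ := by
  have hn : (0 : ℝ) < (n : ℝ) + 1 := by positivity
  have h2 : ((n : ℝ) / (n + 1)) ^ ρ ≤ 1 - ρ / (n + 1) := by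
    have h := rpow_one_add_le_one_add_mul_self (s := -1 / ((n : ℝ) + 1)) (p := ρ)
      (by rw [le_div_iff₀ hn]; nlinarith [(Nat.cast_nonneg n : (0 : ℝ) ≤ n)]) h0 h1
    have e1 : 1 + -1 / ((n : ℝ) + 1) = n / (n + 1) := by field_simp; ring
    have e2 : 1 + ρ * (-1 / ((n : ℝ) + 1)) = 1 - ρ / (n + 1) := by ring
    rwa [e1, e2] at h
  rw [Real.div_rpow (Nat.cast_nonneg n) hn.le, div_le_iff₀ (Real.rpow_pos_of_pos hn ρ)] at h2
  have h3 : 0 ≤ 1 + ρ / ((n : ℝ) + 1) := by positivity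
  calc (1 + ρ / (n + 1)) * (n : ℝ) ^ ρ
      ≤ (1 + ρ / (n + 1)) * ((1 - ρ / (n + 1)) * ((n : ℝ) + 1) ^ ρ) :=
        mul_le_mul_of_nonneg_left h2 h3
    _ = (1 - (ρ / (n + 1)) ^ 2) * ((n : ℝ) + 1) ^ ρ := by ring
    _ ≤ 1 * ((n : ℝ) + 1) ^ ρ := by
        gcongr
        nlinarith [sq_nonneg (ρ / ((n : ℝ) + 1))]
    _ = _ := one_mul _

/-- On the unit circle `‖n + x‖ ^ 2 = n ^ 2 + 2 * n * Re x + 1`, and `hn` absorbs the `1`. -/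
theorem norm_natCast_add_le {x : ℂ} (hx : ‖x‖ = 1) {ρ : ℝ} (h0 : 0 ≤ ρ) {n : ℕ}
    (hn : 1 ≤ 2 * n * (ρ - x.re)) : ‖(n : ℂ) + x‖ ≤ n + ρ := by
  refine le_of_sq_le_sq ?_ (by positivity)
  have h1 : x.re * x.re + x.im * x.im = 1 := by
    have := Complex.sq_norm x
    rw [hx, Complex.normSq_apply] at this
    linarith
  rw [Complex.sq_norm, Complex.normSq_apply]
  simp only [Complex.add_re, Complex.natCast_re, Complex.add_im, Complex.natCast_im, zero_add]
  nlinarith [sq_nonneg ρ]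

theorem exists_le_mul_rpow_of_recurrence {ρ : ℝ} (h0 : 0 ≤ ρ) (h1 : ρ ≤ 1) {u : ℕ → ℝ} {N : ℕ}
    (hN : 1 ≤ N) (hu0 : ∀ n, 0 ≤ u n)
    (hu : ∀ n : ℕ, N ≤ n → u (n + 1) ≤ (1 + ρ / (n + 1)) * u n) :
    ∃ K, 0 ≤ K ∧ ∀ n : ℕ, N ≤ n → u n ≤ K * (n : ℝ) ^ ρ := by
  refine ⟨u N, hu0 N, fun n hn => ?_⟩
  induction n, hn using Nat.le_induction with
  | base =>
    exact le_mul_of_one_le_right (hu0 N) (Real.one_le_rpow (by exact_mod_cast hN) h0)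
  | succ n hn ih =>
    have h3 : 0 ≤ 1 + ρ / ((n : ℝ) + 1) := by positivity
    calc u (n + 1) ≤ (1 + ρ / (n + 1)) * (u N * (n : ℝ) ^ ρ) :=
          (hu n hn).trans (mul_le_mul_of_nonneg_left ih h3)
      _ = u N * ((1 + ρ / (n + 1)) * (n : ℝ) ^ ρ) := by ring
      _ ≤ u N * ((n : ℝ) + 1) ^ ρ :=
          mul_le_mul_of_nonneg_left (one_add_div_mul_rpow_le h0 h1 n) (hu0 N)
      _ = _ := by push_cast; rfl

theorem tendsto_zero_of_recurrence {a : ℕ} {x : ℂ} (hx : ‖x‖ = 1) (hx1 : x ≠ 1) {p : ℕ → ℂ}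
    (h0 : p 0 = 1)
    (hp : ∀ n : ℕ, (n : ℂ) * p n = x * ∑ j ∈ Finset.range (n - a), p j) :
    Tendsto p atTop (𝓝 0) := by
  have hb := norm_le_one_of_recurrence hx h0 hp
  have hre : x.re < 1 := by
    refine lt_of_le_of_ne (hx ▸ Complex.re_le_norm x) fun h => hx1 ?_
    have h2 := Complex.sq_norm x
    rw [hx, Complex.normSq_apply, h] at h2
    have h3 : x.im = 0 := by nlinarith [sq_nonneg x.im]
    exact Complex.ext h h3
  -- Besides exceeding `Re x`, `ρ` must be positive, since `a / ρ` occurs below.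
  obtain ⟨ρ, hρ, hρ1⟩ := exists_between (max_lt hre one_pos)
  obtain ⟨hρx, hρ0⟩ := max_lt_iff.1 hρ
  obtain ⟨M, hM⟩ := exists_nat_ge (1 / (2 * (ρ - x.re)))
  set S : ℕ → ℂ := fun n => ∑ j ∈ Finset.range n, p j with hS
  have hstep : ∀ n : ℕ, M ≤ n → 1 ≤ n → (n : ℝ) * ‖S (n + 1)‖ ≤ (n + ρ) * ‖S n‖ + a := by
    intro n hMn hn
    -- The delay `a` is treated as a perturbation: `S (n - a) - S n` has at most `a` terms, each of
    -- norm at most `1`.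
    have e : (n : ℂ) * S (n + 1) = (n + x) * S n + x * (S (n - a) - S n) := by
      have := hp n
      simp only [hS, Finset.sum_range_succ, mul_add, this]
      ring
    have h1 : 1 ≤ 2 * n * (ρ - x.re) := by
      have h2 : 1 / (2 * (ρ - x.re)) ≤ n := hM.trans (by exact_mod_cast hMn)
      rw [div_le_iff₀ (by linarith)] at h2
      linarith
    calc (n : ℝ) * ‖S (n + 1)‖ = ‖(n : ℂ) * S (n + 1)‖ := by simp
      _ ≤ ‖(n : ℂ) + x‖ * ‖S n‖ + ‖S (n - a) - S n‖ := by
          rw [e]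
          refine (norm_add_le _ _).trans ?_
          simp [hx]
      _ ≤ (n + ρ) * ‖S n‖ + a := by
          gcongr
          · exact norm_natCast_add_le hx hρ0.le h1
          · exact norm_sum_range_sub_le hb a n
  obtain ⟨K, hK0, hK⟩ := exists_le_mul_rpow_of_recurrence hρ0.le hρ1.le
    -- Adding `a / ρ` absorbs the inhomogeneous term `a`; the shift of `S` by one matches the
    -- denominator `n + 1`.
    (u := fun n => ‖S (n + 1)‖ + a / ρ) (N := M + 1) (by omega) (fun n => by positivity) (by
      intro n hn
      have h := hstep (n + 1) (by omega) (by omega)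
      have hn' : (0 : ℝ) < (n : ℝ) + 1 := by positivity
      push_cast at h
      refine le_of_mul_le_mul_left ?_ hn'
      have e : ((n : ℝ) + 1) * ((1 + ρ / (n + 1)) * (‖S (n + 1)‖ + a / ρ))
          = (n + 1 + ρ) * ‖S (n + 1)‖ + a + (n + 1) * (a / ρ) := by
        field_simp
        ring
      rw [e, mul_add]
      linarith)
  have hbound : ∀ n : ℕ, M + 1 ≤ n → ‖p n‖ ≤ K * (n : ℝ) ^ (-(1 - ρ)) + (1 + a) / n := by
    intro n hn
    have hn' : (0 : ℝ) < n := by exact_mod_cast (by omega : 0 < n)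
    have h1 : (n : ℝ) * ‖p n‖ = ‖S (n - a)‖ := by
      have := congrArg norm (hp n)
      simpa [hx] using this
    have h2 : ‖S (n - a)‖ ≤ ‖S n‖ + a := by
      have := norm_sub_norm_le (S (n - a)) (S n)
      have := norm_sum_range_sub_le hb a n
      linarith
    have h3 : ‖S n‖ ≤ ‖S (n + 1)‖ + 1 := by
      have e : S n = S (n + 1) - p n := by simp [hS, Finset.sum_range_succ]
      rw [e]
      exact (norm_sub_le _ _).trans (by linarith [hb n])
    have h4 : ‖S (n + 1)‖ ≤ K * (n : ℝ) ^ ρ :=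
      (le_add_of_nonneg_right (by positivity)).trans (hK n hn)
    refine le_of_mul_le_mul_left ?_ hn'
    have e : (n : ℝ) * (K * (n : ℝ) ^ (-(1 - ρ)) + (1 + a) / n) = K * (n : ℝ) ^ ρ + (1 + a) := by
      have e1 : (n : ℝ) * (n : ℝ) ^ (-(1 - ρ)) = (n : ℝ) ^ ρ := by
        rw [← Real.rpow_one_add' hn'.le (by linarith)]
        congr 1
        ring
      rw [mul_add, mul_left_comm, e1, mul_div_cancel₀ _ hn'.ne']
    rw [e]
    linarith
  refine squeeze_zero_norm' (eventually_atTop.2 ⟨M + 1, hbound⟩) ?_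
  have t1 := ((tendsto_rpow_neg_atTop (sub_pos.2 hρ1)).comp
    tendsto_natCast_atTop_atTop).const_mul K
  have t2 := tendsto_const_div_atTop_nhds_zero_nat (1 + (a : ℝ))
  simpa using t1.add t2

theorem exists_pos_le_of_recurrence {a : ℕ} {p : ℕ → ℝ} (h0 : p 0 = 1)
    (hp : ∀ n : ℕ, (n : ℝ) * p n = ∑ j ∈ Finset.range (n - a), p j) (hnn : ∀ n, 0 ≤ p n) :
    ∃ c, 0 < c ∧ ∀ n, a + 1 ≤ n → c ≤ p n := by
  -- Up to `n = 2 * a + 1` the summand `p 0 = 1` alone suffices. Beyond, `p (m + 1)` is a weighted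
  -- mean of `p m` and `p (m - a)`, and `m - a ≥ a + 1`.
  refine ⟨1 / (2 * a + 1), by positivity, fun n => ?_⟩
  induction n using Nat.strong_induction_on with
  | _ n ih =>
    intro hn
    have hn' : (0 : ℝ) < n := by exact_mod_cast (by omega : 0 < n)
    refine le_of_mul_le_mul_left ?_ hn'
    by_cases hle : n ≤ 2 * a + 1
    · have h1 : 1 ≤ (n : ℝ) * p n := by
        rw [hp n, ← h0]
        exact Finset.single_le_sum (f := p) (fun j _ => hnn j) (Finset.mem_range.2 (by omega))
      refine le_trans ?_ h1
      rw [mul_one_div, div_le_one (by positivity)]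
      exact_mod_cast hle
    · obtain ⟨m, rfl⟩ : ∃ m, n = m + 1 := ⟨n - 1, by omega⟩
      have e : ((m + 1 : ℕ) : ℝ) * p (m + 1) = m * p m + p (m - a) := by
        rw [hp, hp m, ← Finset.sum_range_succ, show m + 1 - a = m - a + 1 by omega]
      have i1 := ih m (by omega) (by omega)
      have i2 := ih (m - a) (by omega) (by omega)
      have i3 := mul_le_mul_of_nonneg_left i1 (Nat.cast_nonneg m : (0 : ℝ) ≤ m)
      rw [e]
      push_cast
      linarith

/-! ### Weights of cycle-length multisets and their recurrence -/

/-- The multisets of natural numbers greater than `a` with sum `n`. -/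
def partsGreater (a n : ℕ) : Finset (Multiset ℕ) :=
  ((Finset.univ : Finset n.Partition).image Nat.Partition.parts).filter fun s => ∀ l ∈ s, a < l

theorem mem_partsGreater {a n : ℕ} {s : Multiset ℕ} :
    s ∈ partsGreater a n ↔ s.sum = n ∧ ∀ l ∈ s, a < l := by
  simp only [partsGreater, Finset.mem_filter, Finset.mem_image, Finset.mem_univ, true_and]
  constructor
  · rintro ⟨⟨P, rfl⟩, h⟩
    exact ⟨P.parts_sum, h⟩
  · rintro ⟨h, h'⟩
    exact ⟨⟨⟨s, fun hl => (Nat.zero_le a).trans_lt (h' _ hl), h⟩, rfl⟩, h'⟩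

/-- The order of the centralizer of a permutation whose cycle lengths, fixed points included,
form `s`. -/
def centralizerCard (s : Multiset ℕ) : ℕ :=
  s.prod * ∏ l ∈ s.toFinset, (s.count l).factorial

theorem centralizerCard_cons (l : ℕ) (s : Multiset ℕ) :
    centralizerCard (l ::ₘ s) = l * (s.count l + 1) * centralizerCard s := by
  -- Both products are extended to one index set; the extra factors are `0! = 1`.
  have h : ∀ t : Multiset ℕ, t.toFinset ⊆ insert l s.toFinset →
      ∏ m ∈ t.toFinset, (t.count m).factorial
        = ∏ m ∈ insert l s.toFinset, (t.count m).factorial := fun t ht =>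
    Finset.prod_subset ht fun m _ hm => by
      rw [Multiset.count_eq_zero_of_notMem (by simpa using hm), Nat.factorial_zero]
  unfold centralizerCard
  rw [h s (Finset.subset_insert _ _), h (l ::ₘ s) (by simp),
    ← Finset.mul_prod_erase _ _ (Finset.mem_insert_self l s.toFinset),
    ← Finset.mul_prod_erase _ (fun m => (s.count m).factorial)
      (Finset.mem_insert_self l s.toFinset),
    Finset.prod_congr rfl fun m hm => by
      rw [Multiset.count_cons_of_ne (Finset.ne_of_mem_erase hm)],
    Multiset.count_cons_self, Multiset.prod_cons, Nat.factorial_succ]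
  ring

theorem centralizerCard_pos {s : Multiset ℕ} (hs : ∀ l ∈ s, 0 < l) : 0 < centralizerCard s :=
  Nat.mul_pos (Multiset.prod_pos hs) (Finset.prod_pos fun _ _ => Nat.factorial_pos _)

section CycleWeight

variable {K : Type*} [Field K]

/-- The weight of a multiset of cycle lengths in the exponential generating function of
permutations by number of cycles. -/
def cycleWeight (x : K) (s : Multiset ℕ) : K :=
  x ^ Multiset.card s / (centralizerCard s : K)

theorem mul_count_mul_cycleWeight [CharZero K] {x : K} {s : Multiset ℕ} (hs : ∀ l ∈ s, 0 < l) {l : ℕ}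
    (hl : l ∈ s) :
    ((s.count l * l : ℕ) : K) * cycleWeight x s = x * cycleWeight x (s.erase l) := by
  obtain ⟨t, rfl⟩ := Multiset.exists_cons_of_mem hl
  have h1 : (centralizerCard t : K) ≠ 0 := by
    exact_mod_cast (centralizerCard_pos fun m hm => hs m (Multiset.mem_cons_of_mem hm)).ne'
  have h2 : (l : K) ≠ 0 := by exact_mod_cast (hs l hl).ne'
  have h3 : (t.count l : K) + 1 ≠ 0 := by exact_mod_cast Nat.succ_ne_zero (t.count l)
  simp only [cycleWeight, centralizerCard_cons, Multiset.erase_cons_head, Multiset.card_cons,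
    Multiset.count_cons_self]
  push_cast
  field_simp
  ring

/-- The coefficients of the exponential generating function of `a`-derangements, the variable
`x` marking the number of cycles. -/
def derangementCoeff (a : ℕ) (x : K) (n : ℕ) : K :=
  ∑ s ∈ partsGreater a n, cycleWeight x s

theorem derangementCoeff_zero (a : ℕ) (x : K) : derangementCoeff a x 0 = 1 := by
  have : partsGreater a 0 = {0} := by
    ext s
    rw [mem_partsGreater, Finset.mem_singleton]
    constructor
    · rintro ⟨h, h'⟩
      refine Multiset.eq_zero_of_forall_notMem fun l hl => ?_
      have := Multiset.le_sum_of_mem hl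
      have := h' l hl
      omega
    · rintro rfl
      simp
  simp [derangementCoeff, this, cycleWeight, centralizerCard]

/-- Write `n` as the sum of the parts of `s`, grouped by value, and delete one part `l`. The rest
has sum `j = n - l`, and `a < l ≤ n` becomes `j < n - a`. -/
theorem natCast_mul_derangementCoeff [CharZero K] (a : ℕ) (x : K) (n : ℕ) :
    (n : K) * derangementCoeff a x n
      = x * ∑ j ∈ Finset.range (n - a), derangementCoeff a x j := by
  have h1 : ∀ s ∈ partsGreater a n, (n : K) * cycleWeight x s
      = ∑ l ∈ s.toFinset, x * cycleWeight x (s.erase l) := by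
    intro s hs
    obtain ⟨hsum, hpos⟩ := mem_partsGreater.1 hs
    have e : n = ∑ l ∈ s.toFinset, s.count l * l := by
      rw [← hsum, Finset.sum_multiset_count]
      simp
    conv_lhs => rw [e]
    rw [Nat.cast_sum, Finset.sum_mul]
    exact Finset.sum_congr rfl fun l hl => mul_count_mul_cycleWeight
      (fun m hm => (Nat.zero_le a).trans_lt (hpos m hm)) (Multiset.mem_toFinset.1 hl)
  simp only [derangementCoeff, Finset.mul_sum]
  rw [Finset.sum_congr rfl h1, Finset.sum_sigma', Finset.sum_sigma']
  refine Finset.sum_bij' (fun p _ => ⟨n - p.2, p.1.erase p.2⟩)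
    (fun p _ => ⟨(n - p.1) ::ₘ p.2, n - p.1⟩) ?_ ?_ ?_ ?_ ?_
  · rintro ⟨s, l⟩ h
    simp only [Finset.mem_sigma, mem_partsGreater, Multiset.mem_toFinset, Finset.mem_range] at h ⊢
    obtain ⟨⟨hsum, hpos⟩, hl⟩ := h
    obtain ⟨t, rfl⟩ := Multiset.exists_cons_of_mem hl
    have := hpos l hl
    simp only [Multiset.sum_cons] at hsum
    rw [Multiset.erase_cons_head]
    exact ⟨by omega, by omega, fun m hm => hpos m (Multiset.mem_cons_of_mem hm)⟩
  · rintro ⟨j, t⟩ h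
    simp only [Finset.mem_sigma, mem_partsGreater, Multiset.mem_toFinset, Finset.mem_range,
      Multiset.sum_cons, Multiset.mem_cons] at h ⊢
    obtain ⟨hj, hsum, hpos⟩ := h
    refine ⟨⟨by omega, ?_⟩, by simp⟩
    rintro m (rfl | hm)
    · omega
    · exact hpos m hm
  · rintro ⟨s, l⟩ h
    simp only [Finset.mem_sigma, mem_partsGreater, Multiset.mem_toFinset] at h
    obtain ⟨⟨hsum, hpos⟩, hl⟩ := h
    have h2 : l ≤ n := hsum ▸ Multiset.le_sum_of_mem hl
    simp only [Nat.sub_sub_self h2, Multiset.cons_erase hl]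
  · rintro ⟨j, t⟩ h
    simp only [Finset.mem_sigma, Finset.mem_range] at h
    have h2 : j ≤ n := by omega
    simp only [Nat.sub_sub_self h2, Multiset.erase_cons_head]
  · rintro ⟨s, l⟩ _
    rfl

end CycleWeight

/-! ### From weights to permutations -/

/-- `cycleType` omits fixed points, but here every part exceeds `a ≥ 1`, so there are none. -/
theorem cycleLengths_eq_iff {a n : ℕ} (ha : 1 ≤ a) {s : Multiset ℕ} (hs : s ∈ partsGreater a n)
    (σ : Equiv.Perm (Fin n)) : cycleLengths σ = s ↔ σ.cycleType = s := by
  obtain ⟨hsum, hpos⟩ := mem_partsGreater.1 hs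
  constructor
  · rintro rfl
    rw [← Equiv.Perm.filter_parts_partition_eq_cycleType]
    exact Multiset.filter_eq_self.2 fun l hl => ha.trans_lt (hpos l hl)
  · rintro rfl
    rw [Equiv.Perm.sum_cycleType] at hsum
    simp [cycleLengths, Equiv.Perm.parts_partition, hsum]

theorem card_cycleLengths_eq_mul_centralizerCard {a n : ℕ} (ha : 1 ≤ a) {s : Multiset ℕ}
    (hs : s ∈ partsGreater a n) :
    (Finset.univ.filter fun σ : Equiv.Perm (Fin n) => cycleLengths σ = s).card
      * centralizerCard s = n.factorial := by
  obtain ⟨hsum, hpos⟩ := mem_partsGreater.1 hs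
  have h := Equiv.Perm.card_of_cycleType_mul_eq (Fin n) s
  rw [if_pos ⟨by simp [hsum], fun l hl => ha.trans_lt (hpos l hl)⟩] at h
  simp only [Fintype.card_fin, hsum, Nat.sub_self, Nat.factorial_zero, one_mul] at h
  simp only [cycleLengths_eq_iff ha hs]
  exact h

theorem sum_pow_numCycles {K : Type*} [Field K] [CharZero K] {a : ℕ} (ha : 1 ≤ a) (x : K)
    (n : ℕ) :
    ∑ σ : Equiv.Perm (Fin n) with IsADerangement a σ, x ^ numCycles σ
      = n.factorial * derangementCoeff a x n := by
  have hsum : ∀ σ : Equiv.Perm (Fin n), (cycleLengths σ).sum = n := fun σ => by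
    simpa [cycleLengths] using σ.partition.parts_sum
  have hmaps : ∀ σ ∈ Finset.univ.filter fun σ : Equiv.Perm (Fin n) => IsADerangement a σ,
      cycleLengths σ ∈ partsGreater a n := fun σ hσ =>
    mem_partsGreater.2 ⟨hsum σ, (Finset.mem_filter.1 hσ).2⟩
  rw [← Finset.sum_fiberwise_of_maps_to hmaps, derangementCoeff,
    Finset.mul_sum]
  refine Finset.sum_congr rfl fun s hs => ?_
  have hpos := (mem_partsGreater.1 hs).2
  have e : (Finset.univ.filter fun σ : Equiv.Perm (Fin n) => IsADerangement a σ).filter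
      (fun σ => cycleLengths σ = s)
      = Finset.univ.filter fun σ : Equiv.Perm (Fin n) => cycleLengths σ = s := by
    ext σ
    simp only [Finset.mem_filter, Finset.mem_univ, true_and, and_iff_right_iff_imp]
    rintro rfl
    exact hpos
  have h0 : (centralizerCard s : K) ≠ 0 := by
    exact_mod_cast (centralizerCard_pos fun l hl => (Nat.zero_le a).trans_lt (hpos l hl)).ne'
  rw [e, Finset.sum_congr rfl (g := fun _ => x ^ Multiset.card s) fun σ hσ => by
    rw [numCycles, (Finset.mem_filter.1 hσ).2], Finset.sum_const, nsmul_eq_mul, cycleWeight,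
    ← card_cycleLengths_eq_mul_centralizerCard ha hs]
  push_cast
  field_simp

theorem numADerangements_eq {K : Type*} [Field K] [CharZero K] {a : ℕ} (ha : 1 ≤ a) (n : ℕ) :
    (numADerangements a n : K) = n.factorial * derangementCoeff a 1 n := by
  rw [← sum_pow_numCycles ha]
  simp [numADerangements]

theorem exists_pos_mul_factorial_le_numADerangements {a : ℕ} (ha : 1 ≤ a) :
    ∃ c : ℝ, 0 < c ∧ ∀ n, a + 1 ≤ n → c * n.factorial ≤ numADerangements a n := by
  obtain ⟨c, hc, h⟩ := exists_pos_le_of_recurrence (p := derangementCoeff a (1 : ℝ))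
    (derangementCoeff_zero a 1)
    (fun n => by rw [natCast_mul_derangementCoeff, one_mul])
    (fun n => Finset.sum_nonneg fun s _ => by simp only [cycleWeight, one_pow]; positivity)
  refine ⟨c, hc, fun n hn => ?_⟩
  rw [numADerangements_eq ha, mul_comm c]
  exact mul_le_mul_of_nonneg_left (h n hn) (Nat.cast_nonneg _)

/-- The mean of `x ^ numCycles` over the `a`-derangements tends to `0` for `x ≠ 1` on the unit
circle. -/
theorem tendsto_sum_pow_numCycles_div {a : ℕ} (ha : 1 ≤ a) {x : ℂ} (hx : ‖x‖ = 1)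
    (hx1 : x ≠ 1) :
    Tendsto (fun n : ℕ => (∑ σ : Equiv.Perm (Fin n) with IsADerangement a σ, x ^ numCycles σ)
      / (numADerangements a n : ℂ)) atTop (𝓝 0) := by
  obtain ⟨c, hc, h⟩ := exists_pos_mul_factorial_le_numADerangements ha
  have ht := (tendsto_zero_of_recurrence hx hx1 (derangementCoeff_zero a x)
    (natCast_mul_derangementCoeff a x)).norm.div_const c
  rw [norm_zero, zero_div] at ht
  refine squeeze_zero_norm' (eventually_atTop.2 ⟨a + 1, fun n hn => ?_⟩) ht
  have hf : (0 : ℝ) < n.factorial := by exact_mod_cast n.factorial_pos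
  rw [sum_pow_numCycles ha, norm_div, norm_mul, Complex.norm_natCast, Complex.norm_natCast]
  calc (n.factorial : ℝ) * ‖derangementCoeff a x n‖ / numADerangements a n
      ≤ n.factorial * ‖derangementCoeff a x n‖ / (c * n.factorial) := by
        gcongr
        exact h n hn
    _ = ‖derangementCoeff a x n‖ / c := by field_simp

/-! ### Roots-of-unity filter and the limit -/

theorem IsPrimitiveRoot.sum_pow_mul_eq_ite {ζ : ℂ} {q : ℕ} (hζ : IsPrimitiveRoot ζ q) (m : ℕ) :
    ∑ i ∈ Finset.range q, (ζ ^ i) ^ m = if q ∣ m then (q : ℂ) else 0 := by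
  simp_rw [← pow_mul, mul_comm _ m, pow_mul]
  split_ifs with h
  · simp [(hζ.pow_eq_one_iff_dvd m).2 h]
  · have h1 : ζ ^ m ≠ 1 := fun e => h ((hζ.pow_eq_one_iff_dvd m).1 e)
    rw [geom_sum_eq h1, ← pow_mul, mul_comm, pow_mul, hζ.pow_eq_one, one_pow, sub_self, zero_div]

/-- The exponent `q - r` replaces `-r` in the filter. -/
theorem modEq_iff_dvd_add_sub {q r k : ℕ} (hr : r < q) : k ≡ r [MOD q] ↔ q ∣ k + (q - r) := by
  rw [← Nat.modEq_zero_iff_dvd]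
  have e : r + (q - r) ≡ 0 [MOD q] := by
    rw [Nat.add_sub_cancel' hr.le]
    exact (Nat.modEq_zero_iff_dvd).2 dvd_rfl
  exact ⟨fun h => (h.add_right _).trans e, fun h => (h.trans e.symm).add_right_cancel' _⟩

theorem mul_numADerangementsCyclesMod {a n q r : ℕ} (hr : r < q) {ζ : ℂ}
    (hζ : IsPrimitiveRoot ζ q) :
    (q : ℂ) * numADerangementsCyclesMod a n r q
      = ∑ i ∈ Finset.range q, (ζ ^ i) ^ (q - r) *
        ∑ σ : Equiv.Perm (Fin n) with IsADerangement a σ, (ζ ^ i) ^ numCycles σ := by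
  simp_rw [Finset.mul_sum]
  rw [Finset.sum_comm]
  simp_rw [← pow_add, add_comm (q - r), hζ.sum_pow_mul_eq_ite, ← modEq_iff_dvd_add_sub hr]
  rw [← Finset.sum_filter, Finset.filter_filter, Finset.sum_const, nsmul_eq_mul, mul_comm]
  rfl

theorem tendsto_numADerangementsCyclesMod_div {a q r : ℕ} (ha : 1 ≤ a) (hr : r < q) :
    Tendsto (fun n : ℕ =>
        (numADerangementsCyclesMod a n r q : ℝ) / (numADerangements a n : ℝ))
      atTop (𝓝 (1 / (q : ℝ))) := by
  have hq : q ≠ 0 := by omega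
  have hζ := Complex.isPrimitiveRoot_exp q hq
  set ζ := Complex.exp (2 * Real.pi * Complex.I / q)
  obtain ⟨c, hc, h⟩ := exists_pos_mul_factorial_le_numADerangements ha
  have hterm : ∀ i ∈ Finset.range q, Tendsto (fun n : ℕ => (ζ ^ i) ^ (q - r) *
      ((∑ σ : Equiv.Perm (Fin n) with IsADerangement a σ, (ζ ^ i) ^ numCycles σ)
        / (numADerangements a n : ℂ))) atTop (𝓝 (if i = 0 then 1 else 0)) := by
    intro i hi
    split_ifs with hi0
    · subst hi0
      refine tendsto_const_nhds.congr' (eventually_atTop.2 ⟨a + 1, fun n hn => ?_⟩)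
      have h1 : (0 : ℝ) < numADerangements a n :=
        (mul_pos hc (by exact_mod_cast n.factorial_pos)).trans_le (h n hn)
      have h2 : (numADerangements a n : ℂ) ≠ 0 := by
        exact_mod_cast h1.ne'
      simp only [pow_zero, one_pow, Finset.sum_const, nsmul_eq_mul, mul_one, one_mul]
      exact (div_self h2).symm
    · have hn : ‖ζ ^ i‖ = 1 := by rw [norm_pow, hζ.norm'_eq_one hq, one_pow]
      have h1 := hζ.pow_ne_one_of_pos_of_lt hi0 (Finset.mem_range.1 hi)
      simpa using (tendsto_sum_pow_numCycles_div ha hn h1).const_mul ((ζ ^ i) ^ (q - r))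
  have hsum := (tendsto_finsetSum _ hterm).div_const (q : ℂ)
  rw [Finset.sum_ite_eq' _ 0, if_pos (Finset.mem_range.2 (Nat.pos_of_ne_zero hq))] at hsum
  have hre := (Complex.continuous_re.tendsto _).comp hsum
  have e : ((1 : ℂ) / q).re = 1 / (q : ℝ) := by
    rw [← Complex.ofReal_natCast, ← Complex.ofReal_one, ← Complex.ofReal_div, Complex.ofReal_re]
  rw [e] at hre
  refine hre.congr fun n => ?_
  have hq' : (q : ℂ) ≠ 0 := by exact_mod_cast hq
  simp only [Function.comp_apply, ← mul_div_assoc]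
  rw [← Finset.sum_div, ← mul_numADerangementsCyclesMod hr hζ, div_right_comm,
    mul_div_cancel_left₀ _ hq', ← Complex.ofReal_natCast, ← Complex.ofReal_natCast,
    ← Complex.ofReal_div, Complex.ofReal_re]

theorem IsADerangement.numCycles_le {a n : ℕ} (ha : 1 ≤ a) {σ : Equiv.Perm (Fin n)}
    (hσ : IsADerangement a σ) : numCycles σ ≤ n / a := by
  have h := Multiset.card_nsmul_le_sum (s := cycleLengths σ) (a := a) fun l hl => (hσ l hl).le
  have hsum : (cycleLengths σ).sum = n := by
    simpa [cycleLengths] using σ.partition.parts_sum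
  rw [hsum, smul_eq_mul] at h
  exact (Nat.le_div_iff_mul_le ha).2 h

/-- No `a`-derangement has more than `n / a` cycles, so further terms vanish and one bound on `N`
serves both truncations. If `n / a < r`, the subtraction truncates to `0` and every term is zero. -/
theorem sum_numADerangementsWithCycles {a q r n N : ℕ} (ha : 1 ≤ a) (hr : r < q)
    (hN : (n / a - r) / q < N) :
    ∑ j ∈ Finset.range N, numADerangementsWithCycles a n (r + j * q)
      = numADerangementsCyclesMod a n r q := by
  have hq : 0 < q := by omega
  unfold numADerangementsWithCycles numADerangementsCyclesMod
  rw [← Finset.card_biUnion]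
  · congr 1
    ext σ
    simp only [Finset.mem_biUnion, Finset.mem_range, Finset.mem_filter, Finset.mem_univ, true_and]
    constructor
    · rintro ⟨j, -, hσ, hj⟩
      exact ⟨hσ, by simp [hj, Nat.ModEq]⟩
    · rintro ⟨hσ, hmod⟩
      have hle := hσ.numCycles_le ha
      have hdiv := Nat.mod_add_div (numCycles σ) q
      rw [show numCycles σ % q = r from Eq.trans hmod (Nat.mod_eq_of_lt hr)] at hdiv
      refine ⟨numCycles σ / q, lt_of_le_of_lt ?_ hN, hσ, by rw [mul_comm, hdiv]⟩
      rw [Nat.le_div_iff_mul_le hq, mul_comm]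
      omega
  · intro i _ j _ hij
    refine Finset.disjoint_left.2 fun σ hi hj => hij ?_
    have h1 := (Finset.mem_filter.1 hi).2.2
    have h2 := (Finset.mem_filter.1 hj).2.2
    exact Nat.eq_of_mul_eq_mul_right hq (by omega)

theorem theorem6 (a q r : ℕ) (ha : 1 ≤ a) (hr : r < q) :
    Tendsto (fun n : ℕ =>
        (∑ j ∈ Finset.range (n / a / q + 1),
          (numADerangementsWithCycles a n (r + j * q) : ℝ)) / (numADerangements a n : ℝ))
      atTop (𝓝 (1 / (q : ℝ))) ∧
    Tendsto (fun n : ℕ =>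
        (∑ j ∈ Finset.range ((n / a - r) / q + 1),
          (numADerangementsWithCycles a n (r + j * q) : ℝ)) / (numADerangements a n : ℝ))
      atTop (𝓝 (1 / (q : ℝ))) ∧
    Tendsto (fun n : ℕ =>
        (numADerangementsCyclesMod a n r q : ℝ) / (numADerangements a n : ℝ))
      atTop (𝓝 (1 / (q : ℝ))) := by
  have h := tendsto_numADerangementsCyclesMod_div ha hr
  refine ⟨h.congr fun n => ?_, h.congr fun n => ?_, h⟩
  · rw [← sum_numADerangementsWithCycles ha hr
      (Nat.lt_succ_of_le (Nat.div_le_div_right (Nat.sub_le (n / a) r))), Nat.cast_sum]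
  · rw [← sum_numADerangementsWithCycles ha hr (Nat.lt_succ_self _), Nat.cast_sum]
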